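/- Let $\mathbf{k}$ be a field. All graphs are finite and simple. For a graph $G$ let $S=\mathbf{k}[x_v : v\in V(G)]$ and let $I(G)=(x_vx_w : \{v,w\}\text{ is an edge of }G)\subseteq S$ be its edge ideal. A set $A\subseteq V(G)$ is dominating if every vertex outside $A$ has a neighbor in $A$; $\gamma(G)$ denotes the least size of a dominating set of $G$, and $i(G)$ the least size of a dominating set that is also independent (both are $0$ for the empty graph). A graph is chordal if every cycle of length at least $4$ has a chord. Then: 1. The class of chordal graphs is hereditary: if $G$ is chordal and $x\in V(G)$, then $G-x$ is chordal. 2. For $f=\gamma$ and also for $f=i$: every chordal graph $G$ with at least one edge has a vertex $v$ with $f(G)\le f(G-v)$. 3. For every chordal graph $G$, the projective dimension of the $S$-module $S/I(G)$ is $$\operatorname{pd}(S/I(G)) = |V(G)| - i(G).$$ -/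

import Mathlib

universe u v

namespace SimpleGraph

/-- A graph is chordal if every cycle of length at least four has a chord: an edge of the graph
which joins two vertices of the cycle and which is not an edge of the cycle. -/
def IsChordal {V : Type u} (G : SimpleGraph V) : Prop :=
  ∀ (a : V) (c : G.Walk a a), c.IsCycle → 4 ≤ c.length →
    ∃ e, c.IsChord e

/-- The graph `G - x`. -/
abbrev deleteVertex {V : Type u} (G : SimpleGraph V) (x : V) :
    SimpleGraph ({x}ᶜ : Set V) :=
  G.induce ({x}ᶜ : Set V)

/-- A set `A` of vertices is dominating if every vertex outside `A` is adjacent to a vertex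
of `A`. -/
def IsDominating {V : Type u} (G : SimpleGraph V) (A : Finset V) : Prop :=
  ∀ w, w ∉ A → ∃ a ∈ A, G.Adj a w

/-- The domination number of a finite graph: the least size of a dominating set. -/
noncomputable def dominationNumber {V : Type u} (G : SimpleGraph V) : ℕ :=
  sInf {m | ∃ A : Finset V, G.IsDominating A ∧ A.card = m}

/-- The independent domination number of a finite graph: the least size of an independent
dominating set. -/
noncomputable def indepDominationNumber {V : Type u} (G : SimpleGraph V) : ℕ :=
  sInf {m | ∃ A : Finset V, G.IsIndepSet (A : Set V) ∧ G.IsDominating A ∧ A.card = m}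

/-- A class of finite graphs is hereditary if it is closed under the deletion of vertices. -/
def IsHereditary (C : ∀ {V : Type u}, SimpleGraph V → Prop) : Prop :=
  ∀ (V : Type u) [Finite V] (G : SimpleGraph V), C G → ∀ x : V, C (G.deleteVertex x)

/-- Whenever a finite graph `G` in the class `C` has at least one edge, there is a vertex `x` with
`f(G) ≤ f(G - x)`. -/
def HasNonDecreasingDeletion (C : ∀ {V : Type u}, SimpleGraph V → Prop)
    (f : ∀ {V : Type u}, SimpleGraph V → ℕ) : Prop :=
  ∀ (V : Type u) [Finite V] (G : SimpleGraph V), C G → (∃ a b, G.Adj a b) →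
    ∃ x : V, f G ≤ f (G.deleteVertex x)

/-- The edge ideal of `G` in the polynomial ring over `k` with one variable for each vertex. -/
noncomputable def edgeIdeal {V : Type u} (k : Type v) [Field k] (G : SimpleGraph V) :
    Ideal (MvPolynomial V k) :=
  Ideal.span {p | ∃ a b, G.Adj a b ∧ p = MvPolynomial.X a * MvPolynomial.X b}

/-- The projective dimension of `S / I(G)` as a module over the polynomial ring `S`. -/
noncomputable def edgeIdealProjDim {V : Type u} (k : Type v) [Field k] (G : SimpleGraph V) :
    WithBot ℕ∞ :=
  CategoryTheory.projectiveDimension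
    (ModuleCat.of (MvPolynomial V k) (MvPolynomial V k ⧸ G.edgeIdeal k))

/-- The minimum defining the independent domination number is attained. -/
theorem exists_card_eq_indepDominationNumber {V : Type u} [Finite V] (G : SimpleGraph V) :
    ∃ A : Finset V, G.IsIndepSet (A : Set V) ∧ G.IsDominating A ∧
      A.card = G.indepDominationNumber := by
  classical
  have := Fintype.ofFinite V
  refine Nat.sInf_mem
    (s := {m | ∃ A : Finset V, G.IsIndepSet (A : Set V) ∧ G.IsDominating A ∧ A.card = m}) ?_
  obtain ⟨A, hA, hmax⟩ := Finset.exists_max_image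
    ((Finset.univ : Finset (Finset V)).filter fun A : Finset V => G.IsIndepSet (A : Set V)) Finset.card
    ⟨∅, by simp [SimpleGraph.IsIndepSet]⟩
  simp only [Finset.mem_filter, Finset.mem_univ, true_and] at hA hmax
  refine ⟨A.card, A, hA, fun w hw => ?_, rfl⟩
  by_contra h
  push Not at h
  have h1 : G.IsIndepSet ((insert w A : Finset V) : Set V) := by
    rw [Finset.coe_insert]
    refine Set.Pairwise.insert hA fun b hb _ => ⟨fun hwb => h b hb hwb.symm, h b hb⟩
  have h2 := hmax _ h1
  rw [Finset.card_insert_of_notMem hw] at h2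
  omega

/-- The subtraction of natural numbers in `|V(G)| - i(G)` does not truncate. -/
theorem indepDominationNumber_le_card {V : Type u} [Finite V] (G : SimpleGraph V) :
    G.indepDominationNumber ≤ Nat.card V := by
  have := Fintype.ofFinite V
  obtain ⟨A, -, -, hA⟩ := G.exists_card_eq_indepDominationNumber
  rw [← hA, Nat.card_eq_fintype_card]
  exact A.card_le_univ

end SimpleGraph

/-! By Dirac's theorem (`IsChordal.exists_simplicial_notMem`), a chordal graph with an edge has a
simplicial vertex `z` with a neighbour `v`, so `N[z] ⊆ N[v]`. Whatever dominates `z` in `G - v` then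
dominates `v` in `G`; this settles both domination numbers.

For projective dimension, take the ideals generated by the edges inside `W` and the variables in
`T`. Both `(I : x_v)` and `I + (x_v)` have this form again. For the upper bound, induct along `R/(I
: x_v) → R/I → R/(I + (x_v))` with the same `v`: an independent dominating set for the colon gains
`v`, and one for `W \ {v}` still dominates `W` because it dominates `z`.

The lower bound needs no chordality. Let `A` be independent and dominating, and let `Y` be the
residue field at the point with coordinates 1 on `A` and 0 elsewhere. Nonzero Ext into `Y` passes
from `(I : x_a)` to `I` for each `a ∈ A`. Taking all these colons leaves the ideal of the `|V| -
|A|` variables outside `A`, a regular sequence killing `Y`, so Ext into `Y` is nonzero in that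
degree. -/

namespace SimpleGraph

/-! ### Chordal graphs and simplicial vertices -/

variable {V : Type u} {G : SimpleGraph V}

/-- An edge of the ambient graph between two vertices of a geodesic is an edge of the geodesic. -/
theorem Walk.mem_edges_of_length_eq_dist {u v a b : V} (p : G.Walk u v)
    (hp : p.length = G.dist u v) (ha : a ∈ p.support) (hb : b ∈ p.support) (hab : G.Adj a b) :
    s(a, b) ∈ p.edges := by
  obtain ⟨i, rfl, hi⟩ := Walk.mem_support_iff_exists_getVert.1 ha
  obtain ⟨j, rfl, hj⟩ := Walk.mem_support_iff_exists_getVert.1 hb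
  clear ha hb
  wlog hij : i ≤ j generalizing i j
  · rw [Sym2.eq_swap]
    exact this j hj i hi hab.symm (by omega)
  have hsub : ((p.drop i).take (j - i)).IsSubwalk p :=
    (Walk.isSubwalk_take _ _).trans (Walk.isSubwalk_drop _ _)
  have hlen := length_eq_dist_of_subwalk hp hsub
  have hj' : (p.drop i).getVert (j - i) = p.getVert j := by
    rw [Walk.drop_getVert]; congr 1; omega
  have hone : ∀ {a b : V} (r : G.Walk a b), r.length = 1 → s(a, b) ∈ r.edges := by
    intro a b r hr
    obtain _ | ⟨_, _ | _⟩ := r <;> simp at hr ⊢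
  -- A subwalk of a geodesic is a geodesic, so the piece between two adjacent vertices has length 1.
  rw [← hj'] at hab ⊢
  exact hsub.edges_subset (hone _ (hlen.trans (dist_eq_one_iff_adj.2 hab)))

/-- In a chordal graph, two neighbours of `x` joined by a path whose interior avoids the closed
neighbourhood of `x` are adjacent. -/
theorem IsChordal.adj_of_reachable (hG : G.IsChordal) {K : SimpleGraph V} {s : Set V} {x u v : V}
    (hK : ∀ a b, K.Adj a b ↔ G.Adj a b ∧ a ∈ s ∧ b ∈ s) (hxs : x ∉ s)
    (hs : ∀ h ∈ s, G.Adj x h → h = u ∨ h = v) (hu : G.Adj x u) (hv : G.Adj x v) (huv : u ≠ v)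
    (hus : u ∈ s) (hr : K.Reachable u v) : G.Adj u v := by
  by_contra hnadj
  -- If `u` and `v` are not adjacent, a geodesic in `K` closed up through `x` is a cycle of length
  -- at least 4. It has no chord at `x`, whose only neighbours in `s` are `u` and `v`, and none
  -- elsewhere, since a geodesic is induced.
  obtain ⟨p, hpath, hp⟩ := hr.exists_path_of_dist
  have hle : K ≤ G := fun a b h => ((hK a b).1 h).1
  have h2 : 1 < p.length := hp ▸ hr.one_lt_dist_of_ne_of_not_adj huv (fun h => hnadj (hle h))
  have hsup : ∀ w ∈ p.support, w ∈ s := by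
    intro w hw
    by_cases h : w = u
    · exact h ▸ hus
    · obtain ⟨i, rfl, hi⟩ := Walk.mem_support_iff_exists_getVert.1 hw
      obtain _ | i := i
      · simp at h
      · exact ((hK _ _).1 (p.adj_getVert_succ (i := i) (by omega))).2.2
  have hxp : x ∉ p.support := fun h => hxs (hsup x h)
  let q : G.Walk u v := p.mapLe hle
  have hqs : q.support = p.support := by simp [q]
  have hqe : q.edges = p.edges := by simp [q]
  have hcyc : (Walk.cons hu (q.concat hv.symm)).IsCycle := by
    rw [Walk.cons_isCycle_iff, Walk.concat_isPath_iff, Walk.edges_concat, hqe, hqs]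
    refine ⟨⟨hpath.mapLe hle, hxp⟩, ?_⟩
    rw [List.concat_eq_append, List.mem_append, List.mem_singleton, Sym2.eq_swap (a := v),
      Sym2.congr_right]
    rintro (h | h)
    · exact hxp (p.fst_mem_support_of_mem_edges h)
    · exact huv h
  obtain ⟨e, he⟩ := hG x _ hcyc (by simp [q]; omega)
  induction e with | _ a b
  rw [Walk.isChord_sym2Mk] at he
  obtain ⟨hab, hne, ha, hb⟩ := he
  simp only [Walk.edges_cons, Walk.edges_concat, Walk.support_cons, Walk.support_concat, hqe, hqs,
    List.mem_cons, List.concat_eq_append, List.mem_append, List.not_mem_nil, or_false,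
    not_or] at hne ha hb
  have key : ∀ b, G.Adj x b → b ∈ p.support → s(x, b) = s(x, u) ∨ s(x, b) = s(v, x) := by
    intro b hxb hb
    rcases hs b (hsup b hb) hxb with rfl | rfl
    · exact Or.inl rfl
    · exact Or.inr Sym2.eq_swap
  have ha' : a = x ∨ a ∈ p.support := by tauto
  have hb' : b = x ∨ b ∈ p.support := by tauto
  rcases ha' with rfl | ha'
  · rcases hb' with rfl | hb'
    · exact hab.ne rfl
    · have := key b hab hb'
      tauto
  · rcases hb' with rfl | hb'
    · have := key a hab.symm ha'
      rw [Sym2.eq_swap] at this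
      tauto
    · exact hne.2.1 (p.mem_edges_of_length_eq_dist hp ha' hb'
        ((hK a b).2 ⟨hab, hsup a ha', hsup b hb'⟩))

/-- Dirac's theorem: for every proper subset `K` of a set `W` of vertices of a chordal graph, if `K`
is a clique then some vertex of `W \ K` is simplicial in the subgraph induced on `W`. -/
theorem IsChordal.exists_simplicial_notMem (hG : G.IsChordal) (W K : Finset V) (hKW : K ⊂ W)
    (hK : G.IsClique (K : Set V)) :
    ∃ z ∈ W, z ∉ K ∧ G.IsClique {a | a ∈ W ∧ G.Adj z a} := by
  classical
  induction W using Finset.strongInduction generalizing K with | _ W ih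
  -- Choosing `x` in `K` when possible gives `K ⊆ N[x]`, so a vertex outside `N[x]` is automatically
  -- outside `K`.
  obtain ⟨x, hxW, hKx⟩ : ∃ x ∈ W, ∀ y ∈ K, y = x ∨ (x ∈ K ∧ G.Adj x y) := by
    rcases K.eq_empty_or_nonempty with rfl | ⟨x, hx⟩
    · obtain ⟨x, hx, -⟩ := Finset.exists_of_ssubset hKW
      exact ⟨x, hx, by simp⟩
    · refine ⟨x, hKW.1 hx, fun y hy => ?_⟩
      by_cases h : y = x
      · exact Or.inl h
      · exact Or.inr ⟨hx, hK hx hy (Ne.symm h)⟩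
  by_cases huniv : ∀ y ∈ W, y ≠ x → G.Adj x y
  · by_cases hKW' : W.erase x ⊆ K.erase x
    · refine ⟨x, hxW, fun hxK => hKW.2 fun w hw => ?_, fun a ha b hb hab => ?_⟩
      · by_cases h : w = x
        · exact h ▸ hxK
        · exact Finset.mem_of_mem_erase (hKW' (Finset.mem_erase.2 ⟨h, hw⟩))
      · have h1 := hKW' (Finset.mem_erase.2 ⟨ha.2.ne', ha.1⟩)
        have h2 := hKW' (Finset.mem_erase.2 ⟨hb.2.ne', hb.1⟩)
        exact hK (Finset.mem_of_mem_erase h1) (Finset.mem_of_mem_erase h2) hab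
    · obtain ⟨z, hz, hzK, hcl⟩ := ih (W.erase x) (Finset.erase_ssubset hxW) (K.erase x)
        ⟨Finset.erase_subset_erase _ hKW.1, hKW'⟩ (hK.subset (by simp))
      have hzx := Finset.ne_of_mem_erase hz
      refine ⟨z, Finset.mem_of_mem_erase hz,
        fun h => hzK (Finset.mem_erase.2 ⟨hzx, h⟩), fun a ha b hb hab => ?_⟩
      by_cases hax : a = x
      · subst hax
        exact huniv b hb.1 hab.symm
      · by_cases hbx : b = x
        · subst hbx
          exact (huniv a ha.1 hab).symm
        · exact hcl ⟨Finset.mem_erase.2 ⟨hax, ha.1⟩, ha.2⟩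
            ⟨Finset.mem_erase.2 ⟨hbx, hb.1⟩, hb.2⟩ hab
  · push Not at huniv
    obtain ⟨y, hyW, hyx, hxy⟩ := huniv
    let restr (s : Set V) : SimpleGraph V :=
      { Adj := fun a b => G.Adj a b ∧ a ∈ s ∧ b ∈ s
        symm := ⟨fun a b h => ⟨h.1.symm, h.2.2, h.2.1⟩⟩
        loopless := ⟨fun a h => h.1.ne rfl⟩ }
    let far : Set V := {a | a ∈ W ∧ a ≠ x ∧ ¬ G.Adj x a}
    -- `H` is the component of `y` in `W \ N[x]`, and `S` is its boundary. `S` is a clique by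
    -- chordality, so induction applies to `S` inside `S ∪ H`, which misses `x`. The vertex found
    -- lies in `H`, and all its neighbours in `W` lie in `S ∪ H`.
    let H : Finset V := W.filter fun a => (restr far).Reachable y a
    let S : Finset V := W.filter fun a => G.Adj x a ∧ ∃ h ∈ H, G.Adj a h
    have hyH : y ∈ H := by simp [H, hyW]
    have hHfar : ∀ h ∈ H, h ∈ far := by
      intro h hh
      obtain ⟨p⟩ := (Finset.mem_filter.1 hh).2
      rcases p.reverse with _ | ⟨hadj, _⟩
      · exact ⟨hyW, hyx, hxy⟩
      · exact hadj.2.1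
    have hclosed : ∀ h ∈ H, ∀ a ∈ far, G.Adj h a → a ∈ H := by
      intro h hh a ha hadj
      refine Finset.mem_filter.2 ⟨ha.1, (Finset.mem_filter.1 hh).2.trans (Adj.reachable ?_)⟩
      exact ⟨hadj, hHfar h hh, ha⟩
    have hnbr : ∀ h ∈ H, ∀ a ∈ W, G.Adj h a → a ∈ S ∪ H := by
      intro h hh a ha hadj
      rw [Finset.mem_union]
      by_cases hxa : G.Adj x a
      · exact Or.inl (Finset.mem_filter.2 ⟨ha, hxa, h, hh, hadj.symm⟩)
      · refine Or.inr (hclosed h hh a ⟨ha, ?_, hxa⟩ hadj)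
        rintro rfl
        exact (hHfar h hh).2.2 hadj.symm
    have hconn : ∀ (s : Set V), (∀ h ∈ H, h ∈ s) → ∀ h ∈ H, (restr s).Reachable y h := by
      intro s hs h hh
      obtain ⟨p⟩ := (Finset.mem_filter.1 hh).2
      have hstep : ∀ a b, (restr far).Walk a b → a ∈ H → (restr s).Reachable a b := by
        intro a b p
        induction p with
        | nil => exact fun _ => Reachable.refl _
        | cons hadj _ ih =>
          intro ha
          have hb := hclosed _ ha _ hadj.2.2 hadj.1
          exact (Adj.reachable (⟨hadj.1, hs _ ha, hs _ hb⟩ : (restr s).Adj _ _)).trans (ih hb)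
      exact hstep _ _ p hyH
    have hScl : G.IsClique (S : Set V) := by
      intro u hu v hv huv
      obtain ⟨-, hxu, hu, huH, hadju⟩ := Finset.mem_filter.1 (Finset.mem_coe.1 hu)
      obtain ⟨-, hxv, hv, hvH, hadjv⟩ := Finset.mem_filter.1 (Finset.mem_coe.1 hv)
      let s : Set V := {a | a ∈ H ∨ a = u ∨ a = v}
      have hs : ∀ h ∈ H, h ∈ s := fun h hh => Or.inl hh
      refine hG.adj_of_reachable (K := restr s) (s := s) (x := x) (fun a b => Iff.rfl) ?_ ?_
        hxu hxv huv (Or.inr (Or.inl rfl)) ?_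
      · rintro (h | rfl | rfl)
        · exact (hHfar x h).2.1 rfl
        · exact hxu.ne rfl
        · exact hxv.ne rfl
      · rintro h (hh | hh) hxh
        · exact absurd hxh (hHfar h hh).2.2
        · exact hh
      · have h1 : (restr s).Adj u hu := ⟨hadju, Or.inr (Or.inl rfl), hs _ huH⟩
        have h2 : (restr s).Adj v hv := ⟨hadjv, Or.inr (Or.inr rfl), hs _ hvH⟩
        exact h1.reachable.trans (((hconn s hs _ huH).symm.trans (hconn s hs _ hvH)).trans
          h2.symm.reachable)
    have hxSH : x ∉ S ∪ H := by
      rw [Finset.mem_union]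
      rintro (h | h)
      · exact (Finset.mem_filter.1 h).2.1.ne rfl
      · exact (hHfar x h).2.1 rfl
    have hSHW : S ∪ H ⊆ W := Finset.union_subset (Finset.filter_subset _ _)
      (Finset.filter_subset _ _)
    have hyS : y ∉ S := fun h => hxy (Finset.mem_filter.1 h).2.1
    obtain ⟨z, hz, hzS, hcl⟩ := ih (S ∪ H)
      ⟨hSHW, fun h => hxSH (h hxW)⟩ S
      ⟨Finset.subset_union_left, fun h => hyS (h (Finset.mem_union_right _ hyH))⟩ hScl
    have hzH : z ∈ H := (Finset.mem_union.1 hz).resolve_left hzS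
    refine ⟨z, hSHW hz, fun hzK => ?_, fun a ha b hb hab => ?_⟩
    · rcases hKx z hzK with h | h
      · exact (hHfar z hzH).2.1 h
      · exact (hHfar z hzH).2.2 h.2
    · exact hcl ⟨hnbr z hzH a ha.1 ha.2, ha.2⟩ ⟨hnbr z hzH b hb.1 hb.2, hb.2⟩ hab

/-- If a set `W` of vertices of a chordal graph spans an edge, then some vertex which is simplicial
in the subgraph induced on `W` has a neighbour in `W`. -/
theorem IsChordal.exists_simplicial_adj (hG : G.IsChordal) {W : Finset V}
    (hW : ∃ a ∈ W, ∃ b ∈ W, G.Adj a b) :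
    ∃ z ∈ W, ∃ v ∈ W, G.Adj z v ∧ ∀ a ∈ W, G.Adj z a → a = v ∨ G.Adj a v := by
  classical
  obtain ⟨a, ha, b, hb, hab⟩ := hW
  -- Isolated vertices of `W` are discarded beforehand, so the simplicial vertex has a neighbour.
  obtain ⟨z, hz, -, hcl⟩ := hG.exists_simplicial_notMem
    (W.filter fun a => ∃ b ∈ W, G.Adj a b) ∅
    (Finset.empty_ssubset.2 ⟨a, Finset.mem_filter.2 ⟨ha, b, hb, hab⟩⟩) (by simp)
  obtain ⟨hzW, v, hv, hzv⟩ := Finset.mem_filter.1 hz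
  have hmem : ∀ a ∈ W, G.Adj z a → a ∈ W.filter fun a => ∃ b ∈ W, G.Adj a b :=
    fun a ha hza => Finset.mem_filter.2 ⟨ha, z, hzW, hza.symm⟩
  refine ⟨z, hzW, v, hv, hzv, fun a ha hza => ?_⟩
  by_cases h : a = v
  · exact Or.inl h
  · exact Or.inr (hcl ⟨hmem a ha hza, hza⟩ ⟨hmem v hv hzv, hzv⟩ h)

/-! ### Vertex deletion and domination -/

theorem IsChordal.deleteVertex (hG : G.IsChordal) (x : V) : (G.deleteVertex x).IsChordal := by
  intro a c hc hlen
  let f : G.deleteVertex x ↪g G := Embedding.induce _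
  obtain ⟨e, he⟩ := hG _ (c.map f.toHom) (hc.map f.injective) (by simpa using hlen)
  induction e with | _ a b
  rw [Walk.isChord_sym2Mk] at he
  obtain ⟨hab, hne, ha, hb⟩ := he
  rw [Walk.support_map, List.mem_map] at ha hb
  obtain ⟨a, ha, rfl⟩ := ha
  obtain ⟨b, hb, rfl⟩ := hb
  refine ⟨s(a, b), Walk.isChord_sym2Mk.2 ⟨f.map_adj_iff.1 hab, fun h => hne ?_, ha, hb⟩⟩
  rw [Walk.edges_map, List.mem_map]
  exact ⟨_, h, rfl⟩

/-- Every chordal graph with an edge has a vertex `v` such that dominating sets of `G - v` are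
dominating in `G`. -/
theorem IsChordal.exists_isDominating_map [Finite V] (hG : G.IsChordal) (hE : ∃ a b, G.Adj a b) :
    ∃ v : V, ∀ A : Finset ({v}ᶜ : Set V), (G.deleteVertex v).IsDominating A →
      G.IsDominating (A.map (Function.Embedding.subtype _)) := by
  have := Fintype.ofFinite V
  obtain ⟨a, b, hab⟩ := hE
  obtain ⟨z, -, v, -, hzv, hz⟩ := hG.exists_simplicial_adj (W := Finset.univ)
    ⟨a, Finset.mem_univ _, b, Finset.mem_univ _, hab⟩
  refine ⟨v, fun A hA w hw => ?_⟩
  by_cases hwv : w = v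
  · subst hwv
    -- Here `w` is the deleted vertex: it is dominated by `z`, or else by the vertex of `A` that
    -- dominates `z`.
    by_cases hzA : (⟨z, hzv.ne⟩ : ({w}ᶜ : Set V)) ∈ A
    · exact ⟨z, Finset.mem_map.2 ⟨_, hzA, rfl⟩, hzv⟩
    · obtain ⟨c, hc, hcz⟩ := hA _ hzA
      refine ⟨c, Finset.mem_map.2 ⟨_, hc, rfl⟩, ?_⟩
      exact (hz c (Finset.mem_univ _) (G.adj_symm hcz)).resolve_left c.2
  · have hwA : (⟨w, hwv⟩ : ({v}ᶜ : Set V)) ∉ A := fun h => hw (Finset.mem_map.2 ⟨_, h, rfl⟩)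
    obtain ⟨c, hc, hcw⟩ := hA _ hwA
    exact ⟨c, Finset.mem_map.2 ⟨_, hc, rfl⟩, hcw⟩

theorem hasNonDecreasingDeletion_dominationNumber :
    HasNonDecreasingDeletion.{u} IsChordal dominationNumber := by
  intro V _ G hG hE
  obtain ⟨v, hv⟩ := hG.exists_isDominating_map hE
  have := Fintype.ofFinite ({v}ᶜ : Set V)
  obtain ⟨A, hA, hcard⟩ : (G.deleteVertex v).dominationNumber ∈
      {m | ∃ A : Finset ({v}ᶜ : Set V), (G.deleteVertex v).IsDominating A ∧ A.card = m} :=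
    Nat.sInf_mem ⟨_, Finset.univ, fun w hw => absurd (Finset.mem_univ w) hw, rfl⟩
  exact ⟨v, Nat.sInf_le ⟨_, hv A hA, by rw [Finset.card_map, hcard]⟩⟩

theorem hasNonDecreasingDeletion_indepDominationNumber :
    HasNonDecreasingDeletion.{u} IsChordal indepDominationNumber := by
  intro V _ G hG hE
  obtain ⟨v, hv⟩ := hG.exists_isDominating_map hE
  obtain ⟨A, hind, hA, hcard⟩ := (G.deleteVertex v).exists_card_eq_indepDominationNumber
  refine ⟨v, Nat.sInf_le ⟨_, ?_, hv A hA, by rw [Finset.card_map, hcard]⟩⟩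
  rw [Finset.coe_map]
  rintro _ ⟨a, ha, rfl⟩ _ ⟨b, hb, rfl⟩ hab
  exact hind ha hb (fun h => hab (by rw [h]))

end SimpleGraph

/-! ### Colon sequences and Ext -/

open CategoryTheory CategoryTheory.Abelian

namespace Ideal

variable {R : Type u} [CommRing R]

/-- The sequence `R / (I : f) → R / I → R / (I + (f))`. -/
noncomputable def colonShortComplex (I J : Ideal R) (f : R) (h : ∀ g, g ∈ J ↔ f * g ∈ I) :
    ShortComplex (ModuleCat.{u} R) :=
  ShortComplex.mk (X₁ := ModuleCat.of R (R ⧸ J)) (X₂ := ModuleCat.of R (R ⧸ I))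
    (X₃ := ModuleCat.of R (R ⧸ (I ⊔ span {f})))
    (ModuleCat.ofHom (Submodule.mapQ J I (LinearMap.mulLeft R f) fun g hg => (h g).1 hg))
    (ModuleCat.ofHom (Submodule.factor le_sup_left)) (by
      refine ModuleCat.hom_ext (Submodule.linearMap_qext _ (LinearMap.ext fun g => ?_))
      exact (Submodule.Quotient.mk_eq_zero _).2
        (mul_mem_right _ _ (mem_sup_right (mem_span_singleton_self f))))

theorem colonShortComplex_shortExact (I J : Ideal R) (f : R) (h : ∀ g, g ∈ J ↔ f * g ∈ I) :
    (colonShortComplex I J f h).ShortExact := by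
  refine ModuleCat.shortComplex_shortExact _ ?_ ?_ ?_
  · intro y
    obtain ⟨p, rfl⟩ := Submodule.Quotient.mk_surjective _ y
    constructor
    · intro hp
      have hp' : p ∈ I ⊔ span {f} := (Submodule.Quotient.mk_eq_zero _).1 hp
      obtain ⟨a, ha, b, hb, rfl⟩ := Submodule.mem_sup.1 hp'
      obtain ⟨c, rfl⟩ := mem_span_singleton'.1 hb
      refine ⟨Submodule.Quotient.mk c, ?_⟩
      refine (Submodule.Quotient.eq _).2 ?_
      have : f * c - (a + c * f) = -a := by ring
      exact this ▸ I.neg_mem ha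
    · rintro ⟨c, hc⟩
      obtain ⟨c, rfl⟩ := Submodule.Quotient.mk_surjective _ c
      have hp : f * c - p ∈ I := (Submodule.Quotient.eq _).1 hc
      refine (Submodule.Quotient.mk_eq_zero _).2 ?_
      have : p = f * c - (f * c - p) := by ring
      rw [this]
      exact sub_mem (mul_mem_right _ _ (mem_sup_right (mem_span_singleton_self f)))
        (mem_sup_left hp)
  · rw [injective_iff_map_eq_zero]
    intro y hy
    obtain ⟨p, rfl⟩ := Submodule.Quotient.mk_surjective _ y
    exact (Submodule.Quotient.mk_eq_zero _).2 ((h p).2 ((Submodule.Quotient.mk_eq_zero _).1 hy))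
  · exact Submodule.factor_surjective (le_sup_left : I ≤ I ⊔ span {f})

theorem hasProjectiveDimensionLT_quotient_of_colon {I J : Ideal R} {f : R}
    (h : ∀ g, g ∈ J ↔ f * g ∈ I) {n : ℕ}
    (h₁ : HasProjectiveDimensionLT (ModuleCat.of R (R ⧸ J)) n)
    (h₃ : HasProjectiveDimensionLT (ModuleCat.of R (R ⧸ (I ⊔ span {f}))) n) :
    HasProjectiveDimensionLT (ModuleCat.of R (R ⧸ I)) n :=
  (colonShortComplex_shortExact I J f h).hasProjectiveDimensionLT_X₂ n h₁ h₃

/-- Here `h` says that `f` is a nonzerodivisor on `R / J`; the colon sequence with `I = J` costs one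
dimension. -/
theorem hasProjectiveDimensionLT_quotient_sup_span {J : Ideal R} {f : R}
    (h : ∀ g, g ∈ J ↔ f * g ∈ J) {n : ℕ}
    (hJ : HasProjectiveDimensionLT (ModuleCat.of R (R ⧸ J)) n) :
    HasProjectiveDimensionLT (ModuleCat.of R (R ⧸ (J ⊔ span {f}))) (n + 1) :=
  (colonShortComplex_shortExact J J f h).hasProjectiveDimensionLT_X₃ n hJ
    (have := hJ; hasProjectiveDimensionLT_of_ge (ModuleCat.of R (R ⧸ J)) n _ n.le_succ)

theorem hasProjectiveDimensionLT_quotient_bot :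
    HasProjectiveDimensionLT (ModuleCat.of R (R ⧸ (⊥ : Ideal R))) 1 := by
  have : Module.Projective R (R ⧸ (⊥ : Ideal R)) :=
    Module.Projective.of_equiv (Submodule.quotEquivOfEqBot (⊥ : Ideal R) rfl).symm
  have : Projective (ModuleCat.of R (R ⧸ (⊥ : Ideal R))) := (IsProjective.iff_projective _).1 this
  infer_instance

theorem nontrivial_ext_quotient_bot {Y : ModuleCat.{u} R} [Nontrivial Y] :
    Nontrivial (Ext (ModuleCat.of R (R ⧸ (⊥ : Ideal R))) Y 0) := by
  obtain ⟨y, hy⟩ := exists_ne (0 : Y)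
  let φ : (R ⧸ (⊥ : Ideal R)) →ₗ[R] Y := Submodule.liftQ _ (LinearMap.toSpanSingleton R Y y) bot_le
  refine ⟨Ext.mk₀ (ModuleCat.ofHom φ), 0, fun h => hy ?_⟩
  rw [Ext.mk₀_eq_zero_iff] at h
  have h1 : φ (Submodule.Quotient.mk 1) = 0 := by
    have : φ = 0 := by simpa using congrArg ModuleCat.Hom.hom h
    rw [this]; rfl
  rw [← one_smul R y]
  exact h1

/-- If `f` is regular on `R / J` and kills `Y`, then `Ext^n(R / J, Y) ≠ 0` implies
`Ext^(n + 1)(R / (J + (f)), Y) ≠ 0`. -/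
theorem nontrivial_ext_quotient_sup_span {J : Ideal R} {f : R}
    (h : ∀ g, g ∈ J ↔ f * g ∈ J) {Y : ModuleCat.{u} R} (hY : ∀ y : Y, f • y = 0) {n : ℕ}
    (hn : Nontrivial (Ext (ModuleCat.of R (R ⧸ J)) Y n)) :
    Nontrivial (Ext (ModuleCat.of R (R ⧸ (J ⊔ span {f}))) Y (n + 1)) := by
  obtain ⟨x, hx⟩ := exists_ne (0 : Ext (ModuleCat.of R (R ⧸ J)) Y n)
  have hS := colonShortComplex_shortExact J J f h
  refine ⟨hS.extClass.comp x (add_comm 1 n), 0, fun h0 => hx ?_⟩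
  obtain ⟨x₂, hx₂⟩ := Ext.contravariant_sequence_exact₁ hS Y x (add_comm 1 n) h0
  -- The first map is multiplication by `f`. By linearity it acts on Ext through `f` on `Y`, hence
  -- as zero, so the connecting map is injective.
  have hf : (colonShortComplex J J f h).f = f • 𝟙 (ModuleCat.of R (R ⧸ J)) :=
    ModuleCat.hom_ext (Submodule.linearMap_qext _ (LinearMap.ext fun g => rfl))
  have hY' : f • 𝟙 Y = 0 :=
    ModuleCat.hom_ext (LinearMap.ext hY)
  have h2 (x₂ : Ext (ModuleCat.of R (R ⧸ J)) Y n) :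
      (Ext.mk₀ (f • 𝟙 (ModuleCat.of R (R ⧸ J)))).comp x₂ (zero_add n) = 0 := by
    rw [Ext.mk₀_smul, Ext.smul_comp, Ext.mk₀_id_comp, Ext.smul_eq_comp_mk₀, hY', Ext.mk₀_zero,
      Ext.comp_zero]
  rw [hf] at hx₂
  exact hx₂.symm.trans (h2 x₂)

/-- If `f` acts on `Y` as the identity, then `Ext^n(R / (I : f), Y) ≠ 0` implies
`Ext^n(R / I, Y) ≠ 0`. -/
theorem nontrivial_ext_quotient_of_colon {I J : Ideal R} {f : R}
    (h : ∀ g, g ∈ J ↔ f * g ∈ I) {Y : ModuleCat.{u} R} (hY : ∀ y : Y, f • y = y) {n : ℕ}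
    (hn : Nontrivial (Ext (ModuleCat.of R (R ⧸ J)) Y n)) :
    Nontrivial (Ext (ModuleCat.of R (R ⧸ I)) Y n) := by
  obtain ⟨x, hx⟩ := exists_ne (0 : Ext (ModuleCat.of R (R ⧸ J)) Y n)
  have hS := colonShortComplex_shortExact I J f h
  -- On this Ext group `f` acts as the identity through `Y` and as zero through the quotient. The
  -- obstruction to lifting `x` therefore vanishes.
  have hzero : ∀ e : Ext (ModuleCat.of R (R ⧸ (I ⊔ span {f}))) Y (n + 1), e = 0 := by
    intro e
    have h1 : f • e = e := by
      have hY' : f • 𝟙 Y = 𝟙 Y := ModuleCat.hom_ext (LinearMap.ext hY)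
      rw [Ext.smul_eq_comp_mk₀, hY', Ext.comp_mk₀_id]
    have h2 : f • 𝟙 (ModuleCat.of R (R ⧸ (I ⊔ span {f}))) = 0 :=
      ModuleCat.hom_ext (Submodule.linearMap_qext _ (LinearMap.ext fun g =>
        (Submodule.Quotient.mk_eq_zero _).2
          (mul_mem_right _ _ (mem_sup_right (mem_span_singleton_self f)))))
    have h3 : f • e = 0 := by
      rw [← e.mk₀_id_comp, ← Ext.smul_comp, ← Ext.mk₀_smul, h2, Ext.mk₀_zero, Ext.zero_comp]
    exact h1.symm.trans h3
  obtain ⟨x₂, hx₂⟩ := Ext.contravariant_sequence_exact₁ hS Y x (add_comm 1 n) (hzero _)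
  refine ⟨x₂, 0, fun h0 => hx ?_⟩
  rw [← hx₂, h0]
  exact Ext.comp_zero (Ext.mk₀ (colonShortComplex I J f h).f) _ _ _ (zero_add n)

end Ideal


/-! ### Ideals generated by edges and variables -/

namespace SimpleGraph

variable {V : Type u} (k : Type v) [Field k] (G : SimpleGraph V)

/-- The exponents of the edges of `G` inside `W` and of the variables in `T`. -/
def edgeExponents (W T : Finset V) : Set (V →₀ ℕ) :=
  {s | (∃ a ∈ W, ∃ b ∈ W, G.Adj a b ∧ s = Finsupp.single a 1 + Finsupp.single b 1) ∨
    ∃ t ∈ T, s = Finsupp.single t 1}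

/-- The sum of the edge ideal of the subgraph induced on `W` and the ideal generated by the
variables in `T`. -/
noncomputable def edgeVarIdeal (W T : Finset V) : Ideal (MvPolynomial V k) :=
  Ideal.span ((fun s => MvPolynomial.monomial s 1) '' G.edgeExponents W T)

variable {G}

theorem exists_mem_edgeExponents_le {W T : Finset V} {m : V →₀ ℕ} :
    (∃ s ∈ G.edgeExponents W T, s ≤ m) ↔
      (∃ a ∈ W, ∃ b ∈ W, G.Adj a b ∧ m a ≠ 0 ∧ m b ≠ 0) ∨ ∃ t ∈ T, m t ≠ 0 := by
  classical
  constructor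
  · rintro ⟨s, ⟨a, ha, b, hb, hab, rfl⟩ | ⟨t, ht, rfl⟩, hs⟩
    · have h1 := hs a
      have h2 := hs b
      simp only [Finsupp.add_apply, Finsupp.single_eq_same] at h1 h2
      exact Or.inl ⟨a, ha, b, hb, hab, by omega, by omega⟩
    · have h1 := hs t
      simp only [Finsupp.single_eq_same] at h1
      exact Or.inr ⟨t, ht, by omega⟩
  · rintro (⟨a, ha, b, hb, hab, h1, h2⟩ | ⟨t, ht, h1⟩)
    · refine ⟨_, Or.inl ⟨a, ha, b, hb, hab, rfl⟩, fun c => ?_⟩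
      have := hab.ne
      simp only [Finsupp.add_apply, Finsupp.single_apply]
      split_ifs <;> subst_vars <;> first | omega | contradiction
    · refine ⟨_, Or.inr ⟨t, ht, rfl⟩, fun c => ?_⟩
      simp only [Finsupp.single_apply]
      split_ifs <;> subst_vars <;> omega

variable {k}

/-- Membership in a monomial ideal is tested on each monomial, so all comparisons of ideals below
become combinatorics of supports. -/
theorem mem_edgeVarIdeal {W T : Finset V} {p : MvPolynomial V k} :
    p ∈ G.edgeVarIdeal k W T ↔ ∀ m ∈ p.support,
      (∃ a ∈ W, ∃ b ∈ W, G.Adj a b ∧ m a ≠ 0 ∧ m b ≠ 0) ∨ ∃ t ∈ T, m t ≠ 0 := by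
  rw [edgeVarIdeal, MvPolynomial.mem_ideal_span_monomial_image]
  simp only [exists_mem_edgeExponents_le]

theorem X_mul_mem_edgeVarIdeal {W T : Finset V} {p : MvPolynomial V k} {v : V} :
    MvPolynomial.X v * p ∈ G.edgeVarIdeal k W T ↔ ∀ m ∈ p.support,
      (∃ a ∈ W, ∃ b ∈ W, G.Adj a b ∧ (a = v ∨ m a ≠ 0) ∧ (b = v ∨ m b ≠ 0)) ∨
        ∃ t ∈ T, t = v ∨ m t ≠ 0 := by
  classical
  have h (m : V →₀ ℕ) (a : V) : (Finsupp.single v 1 + m : V →₀ ℕ) a ≠ 0 ↔ a = v ∨ m a ≠ 0 := by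
    rw [Finsupp.add_apply, Finsupp.single_apply]
    split_ifs with hav
    · simp [hav]
    · simp [Ne.symm hav]
  simp only [mem_edgeVarIdeal, MvPolynomial.support_X_mul, Finset.mem_map, addLeftEmbedding_apply,
    forall_exists_index, and_imp, forall_apply_eq_imp_iff₂, h]

theorem edgeVarIdeal_sup_span_X [DecidableEq V] (W T : Finset V) (v : V) :
    G.edgeVarIdeal k W T ⊔ Ideal.span {MvPolynomial.X v} =
      G.edgeVarIdeal k (W.erase v) (insert v T) := by
  have h : G.edgeVarIdeal k W T ⊔ Ideal.span {MvPolynomial.X v} =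
      Ideal.span ((fun s => MvPolynomial.monomial s 1) ''
        (G.edgeExponents W T ∪ {Finsupp.single v 1})) := by
    rw [edgeVarIdeal, Set.image_union, Set.image_singleton, Ideal.span_union]
    rfl
  ext p
  rw [h, MvPolynomial.mem_ideal_span_monomial_image, mem_edgeVarIdeal]
  refine forall₂_congr fun m _ => ?_
  have hv : (Finsupp.single v 1 ≤ m) ↔ m v ≠ 0 := by
    rw [Finsupp.single_le_iff]; omega
  simp only [Set.mem_union, Set.mem_singleton_iff, or_and_right, exists_or, exists_eq_left,
    exists_mem_edgeExponents_le, hv]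
  grind

/-- Dividing by `x_v` turns each edge at `v` into a variable, and these variables absorb every other
edge meeting a neighbour of `v`. If `v` were in `T`, the colon would be the unit ideal. -/
theorem mem_edgeVarIdeal_neighbors_iff [DecidableEq V] [DecidableRel G.Adj] {W T : Finset V} {v : V}
    (hvW : v ∈ W) (hvT : v ∉ T) (p : MvPolynomial V k) :
    p ∈ G.edgeVarIdeal k (W.filter fun a => a ≠ v ∧ ¬ G.Adj v a) (T ∪ W.filter (G.Adj v)) ↔
      MvPolynomial.X v * p ∈ G.edgeVarIdeal k W T := by
  rw [mem_edgeVarIdeal, X_mul_mem_edgeVarIdeal]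
  refine forall₂_congr fun m _ => ?_
  simp only [Finset.mem_filter, Finset.mem_union]
  constructor
  · rintro (⟨a, ha, b, hb, hab, h1, h2⟩ | ⟨t, ht | ht, h⟩)
    · exact Or.inl ⟨a, ha.1, b, hb.1, hab, Or.inr h1, Or.inr h2⟩
    · exact Or.inr ⟨t, ht, Or.inr h⟩
    · exact Or.inl ⟨v, hvW, t, ht.1, ht.2, Or.inl rfl, Or.inr h⟩
  · rintro (⟨a, ha, b, hb, hab, h1, h2⟩ | ⟨t, ht, rfl | h⟩)
    · by_cases hva : G.Adj v a
      · exact Or.inr ⟨a, Or.inr ⟨ha, hva⟩, h1.resolve_left hva.ne'⟩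
      · by_cases hvb : G.Adj v b
        · exact Or.inr ⟨b, Or.inr ⟨hb, hvb⟩, h2.resolve_left hvb.ne'⟩
        · have hav : a ≠ v := by rintro rfl; exact hvb hab
          have hbv : b ≠ v := by rintro rfl; exact hva hab.symm
          exact Or.inl ⟨a, ⟨ha, hav, hva⟩, b, ⟨hb, hbv, hvb⟩, hab, h1.resolve_left hav,
            h2.resolve_left hbv⟩
    · exact absurd ht hvT
    · exact Or.inr ⟨t, Or.inl ht, h⟩

theorem edgeVarIdeal_empty_empty : G.edgeVarIdeal k ∅ ∅ = ⊥ := by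
  simp [edgeVarIdeal, edgeExponents]

theorem edgeVarIdeal_eq_of_not_adj {W : Finset V} (hW : ∀ a ∈ W, ∀ b ∈ W, ¬ G.Adj a b)
    (T : Finset V) : G.edgeVarIdeal k W T = G.edgeVarIdeal k ∅ T := by
  ext p
  rw [mem_edgeVarIdeal, mem_edgeVarIdeal]
  refine forall₂_congr fun m _ => or_congr_left ?_
  constructor
  · rintro ⟨a, ha, b, hb, hab, -⟩
    exact absurd hab (hW a ha b hb)
  · rintro ⟨a, ha, -⟩
    exact absurd ha (Finset.notMem_empty a)

theorem edgeVarIdeal_univ_empty [Fintype V] :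
    G.edgeVarIdeal k Finset.univ ∅ = G.edgeIdeal k := by
  rw [edgeVarIdeal, edgeIdeal]
  congr 1
  ext p
  constructor
  · rintro ⟨s, ⟨a, -, b, -, hab, rfl⟩ | ⟨t, ht, -⟩, rfl⟩
    · exact ⟨a, b, hab, by simp [MvPolynomial.X, MvPolynomial.monomial_mul]⟩
    · exact absurd ht (Finset.notMem_empty t)
  · rintro ⟨a, b, hab, rfl⟩
    exact ⟨_, Or.inl ⟨a, Finset.mem_univ a, b, Finset.mem_univ b, hab, rfl⟩,
      by simp [MvPolynomial.X, MvPolynomial.monomial_mul]⟩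

theorem mem_edgeVarIdeal_empty_iff_X_mul {T : Finset V} {t : V} (ht : t ∉ T)
    (p : MvPolynomial V k) :
    p ∈ G.edgeVarIdeal k ∅ T ↔ MvPolynomial.X t * p ∈ G.edgeVarIdeal k ∅ T := by
  rw [mem_edgeVarIdeal, X_mul_mem_edgeVarIdeal]
  refine forall₂_congr fun m _ => ?_
  simp only [Finset.notMem_empty, false_and, exists_false, false_or]
  refine exists_congr fun a => and_congr_right fun ha => ?_
  have : a ≠ t := by rintro rfl; exact ht ha
  simp [this]

theorem edgeVarIdeal_empty_insert [DecidableEq V] (T : Finset V) (t : V) :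
    G.edgeVarIdeal k ∅ (insert t T) =
      G.edgeVarIdeal k ∅ T ⊔ Ideal.span {MvPolynomial.X t} := by
  rw [edgeVarIdeal_sup_span_X, Finset.erase_empty]

variable (k G)

theorem hasProjectiveDimensionLT_edgeVarIdeal_empty (T : Finset V) :
    HasProjectiveDimensionLT
      (ModuleCat.of (MvPolynomial V k) (MvPolynomial V k ⧸ G.edgeVarIdeal k ∅ T)) (T.card + 1) := by
  classical
  induction T using Finset.induction_on with
  | empty =>
    rw [edgeVarIdeal_empty_empty]
    exact Ideal.hasProjectiveDimensionLT_quotient_bot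
  | insert t T ht ih =>
    rw [Finset.card_insert_of_notMem ht, edgeVarIdeal_empty_insert]
    exact Ideal.hasProjectiveDimensionLT_quotient_sup_span
      (mem_edgeVarIdeal_empty_iff_X_mul ht) ih

/-! ### The upper bound for chordal graphs -/

variable {k G}

/-- Only `v` is lost: its neighbours move from `W` to `T`. This loss of one balances the addition of
`v` to a dominating set. -/
theorem card_filter_add_card_union_filter [DecidableEq V] [DecidableRel G.Adj] {W T : Finset V}
    (hWT : Disjoint W T) {v : V} (hv : v ∈ W) :
    (W.filter fun a => a ≠ v ∧ ¬ G.Adj v a).card + (T ∪ W.filter (G.Adj v)).card + 1 =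
      W.card + T.card := by
  rw [Finset.card_union_of_disjoint (hWT.symm.mono_right (Finset.filter_subset _ _)),
    ← Finset.card_erase_add_one hv,
    ← Finset.card_filter_add_card_filter_not (s := W.erase v) (G.Adj v)]
  have h1 : (W.erase v).filter (G.Adj v) = W.filter (G.Adj v) := by
    ext a
    simp only [Finset.mem_filter, Finset.mem_erase]
    exact ⟨fun h => ⟨h.1.2, h.2⟩, fun h => ⟨⟨h.2.ne', h.1⟩, h.2⟩⟩
  have h2 : (W.erase v).filter (fun a => ¬ G.Adj v a) =
      W.filter fun a => a ≠ v ∧ ¬ G.Adj v a := by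
    ext a
    simp only [Finset.mem_filter, Finset.mem_erase]
    tauto
  rw [h1, h2]
  omega

theorem disjoint_filter_union_filter [DecidableEq V] [DecidableRel G.Adj] {W T : Finset V}
    (hWT : Disjoint W T) (v : V) :
    Disjoint (W.filter fun a => a ≠ v ∧ ¬ G.Adj v a) (T ∪ W.filter (G.Adj v)) := by
  rw [Finset.disjoint_union_right]
  refine ⟨hWT.mono_left (Finset.filter_subset _ _), Finset.disjoint_left.2 fun a ha hb => ?_⟩
  exact (Finset.mem_filter.1 ha).2.2 (Finset.mem_filter.1 hb).2

/-- The bound `d` is a parameter, so the same `d` serves both outer terms of the colon sequence; `d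
+ 1` encodes dimension at most `d`. -/
theorem IsChordal.hasProjectiveDimensionLT_edgeVarIdeal (hG : G.IsChordal) (W T : Finset V)
    (hWT : Disjoint W T) (d : ℕ)
    (hd : ∀ A ⊆ W, G.IsIndepSet (A : Set V) → (∀ w ∈ W, w ∉ A → ∃ a ∈ A, G.Adj a w) →
      W.card + T.card ≤ d + A.card) :
    HasProjectiveDimensionLT
      (ModuleCat.of (MvPolynomial V k) (MvPolynomial V k ⧸ G.edgeVarIdeal k W T)) (d + 1) := by
  classical
  induction W using Finset.strongInduction generalizing T d with | _ W ih
  by_cases hE : ∃ a ∈ W, ∃ b ∈ W, G.Adj a b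
  · obtain ⟨z, hz, v, hv, hzv, hsimp⟩ := hG.exists_simplicial_adj hE
    refine Ideal.hasProjectiveDimensionLT_quotient_of_colon
      (mem_edgeVarIdeal_neighbors_iff hv (Finset.disjoint_left.1 hWT hv)) ?_ ?_
    · refine ih _ ?_ _ (disjoint_filter_union_filter hWT v) _ fun A hA hind hdom => ?_
      · exact Finset.filter_ssubset.2 ⟨v, hv, fun h => h.1 rfl⟩
      · have hA' : ∀ a ∈ A, a ∈ W ∧ a ≠ v ∧ ¬ G.Adj v a := fun a ha => Finset.mem_filter.1 (hA ha)
        have hvA : v ∉ A := fun h => (hA' v h).2.1 rfl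
        have h := hd (insert v A) (Finset.insert_subset hv fun a ha => (hA' a ha).1) ?_ ?_
        · rw [Finset.card_insert_of_notMem hvA] at h
          have := card_filter_add_card_union_filter (G := G) hWT hv
          omega
        · rw [Finset.coe_insert]
          exact Set.Pairwise.insert hind fun b hb _ =>
            ⟨(hA' b hb).2.2, fun h => (hA' b hb).2.2 h.symm⟩
        · intro w hw hwA
          rw [Finset.mem_insert, not_or] at hwA
          by_cases hvw : G.Adj v w
          · exact ⟨v, Finset.mem_insert_self _ _, hvw⟩
          · obtain ⟨a, ha, haw⟩ := hdom w (Finset.mem_filter.2 ⟨hw, hwA.1, hvw⟩) hwA.2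
            exact ⟨a, Finset.mem_insert_of_mem ha, haw⟩
    · rw [edgeVarIdeal_sup_span_X]
      have hvT := Finset.disjoint_left.1 hWT hv
      refine ih _ (Finset.erase_ssubset hv) _ ?_ _ fun A hA hind hdom => ?_
      · rw [Finset.disjoint_insert_right]
        exact ⟨Finset.notMem_erase v W, hWT.mono_left (Finset.erase_subset _ _)⟩
      · rw [Finset.card_insert_of_notMem hvT]
        have := Finset.card_erase_add_one hv
        have := hd A (hA.trans (Finset.erase_subset _ _)) hind fun w hw hwA => ?_
        · omega
        · by_cases hwv : w = v
          · subst hwv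
            by_cases hzA : z ∈ A
            · exact ⟨z, hzA, hzv⟩
            · obtain ⟨a, ha, haz⟩ := hdom z (Finset.mem_erase.2 ⟨hzv.ne, hz⟩) hzA
              obtain ⟨haw, haW⟩ := Finset.mem_erase.1 (hA ha)
              exact ⟨a, ha, (hsimp a haW haz.symm).resolve_left haw⟩
          · exact hdom w (Finset.mem_erase.2 ⟨hwv, hw⟩) hwA
  · push Not at hE
    rw [edgeVarIdeal_eq_of_not_adj hE]
    -- Without edges `W` itself is independent and dominating, so `hd` reduces to `T.card ≤ d`.
    have h := hd W subset_rfl (fun a ha b hb _ => hE a ha b hb) fun w hw hwW => absurd hw hwW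
    have := G.hasProjectiveDimensionLT_edgeVarIdeal_empty k T
    exact hasProjectiveDimensionLT_of_ge _ (T.card + 1) _ (by omega)

/-! ### The lower bound for arbitrary graphs -/

theorem nontrivial_ext_edgeVarIdeal_empty (T : Finset V) {Y : ModuleCat.{max u v} (MvPolynomial V k)}
    [Nontrivial Y] (hT : ∀ t ∈ T, ∀ y : Y, (MvPolynomial.X t : MvPolynomial V k) • y = 0) :
    Nontrivial (Ext (ModuleCat.of (MvPolynomial V k)
      (MvPolynomial V k ⧸ G.edgeVarIdeal k ∅ T)) Y T.card) := by
  classical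
  induction T using Finset.induction_on with
  | empty =>
    rw [edgeVarIdeal_empty_empty]
    exact Ideal.nontrivial_ext_quotient_bot
  | insert t T ht ih =>
    rw [Finset.card_insert_of_notMem ht, edgeVarIdeal_empty_insert]
    exact Ideal.nontrivial_ext_quotient_sup_span (mem_edgeVarIdeal_empty_iff_X_mul ht)
      (hT t (Finset.mem_insert_self _ _))
      (ih fun s hs => hT s (Finset.mem_insert_of_mem hs))

/-- Taking the colon by one `v ∈ A` removes `v` from `A` and keeps `n`. Once `A` is empty,
domination forces `W = ∅`, leaving `n` variables. -/
theorem nontrivial_ext_edgeVarIdeal {Y : ModuleCat.{max u v} (MvPolynomial V k)} [Nontrivial Y]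
    (A W T : Finset V) (hWT : Disjoint W T) (hA : A ⊆ W) (hind : G.IsIndepSet (A : Set V))
    (hdom : ∀ w ∈ W, w ∉ A → ∃ a ∈ A, G.Adj a w)
    (hone : ∀ a ∈ A, ∀ y : Y, (MvPolynomial.X a : MvPolynomial V k) • y = y)
    (hW : ∀ w ∈ W, w ∉ A → ∀ y : Y, (MvPolynomial.X w : MvPolynomial V k) • y = 0)
    (hT : ∀ t ∈ T, ∀ y : Y, (MvPolynomial.X t : MvPolynomial V k) • y = 0) (n : ℕ)
    (hn : n + A.card = W.card + T.card) :
    Nontrivial (Ext (ModuleCat.of (MvPolynomial V k)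
      (MvPolynomial V k ⧸ G.edgeVarIdeal k W T)) Y n) := by
  classical
  induction A using Finset.induction_on generalizing W T with
  | empty =>
    obtain rfl : W = ∅ := Finset.eq_empty_of_forall_notMem fun w hw => by
      simpa using hdom w hw (Finset.notMem_empty w)
    obtain rfl : n = T.card := by simpa using hn
    exact nontrivial_ext_edgeVarIdeal_empty T hT
  | insert v A hvA ih =>
    have hv : v ∈ W := hA (Finset.mem_insert_self _ _)
    have hvadj : ∀ a ∈ A, ¬ G.Adj v a := fun a ha =>
      hind (by simp) (by simp [ha]) (fun h => hvA (h ▸ ha))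
    refine Ideal.nontrivial_ext_quotient_of_colon
      (mem_edgeVarIdeal_neighbors_iff hv (Finset.disjoint_left.1 hWT hv))
      (hone v (Finset.mem_insert_self _ _)) ?_
    have hnot : ∀ w, w ≠ v → w ∉ A → w ∉ insert v A := fun w h1 h2 h =>
      (Finset.mem_insert.1 h).elim h1 h2
    refine ih _ _ (disjoint_filter_union_filter hWT v) (fun a ha => ?_)
      (hind.mono (by simp)) (fun w hw hwA => ?_)
      (fun a ha => hone a (Finset.mem_insert_of_mem ha)) (fun w hw hwA => ?_) (fun t ht => ?_) ?_
    · exact Finset.mem_filter.2 ⟨hA (Finset.mem_insert_of_mem ha), fun h => hvA (h ▸ ha),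
        hvadj a ha⟩
    · obtain ⟨hwW, hwv, hvw⟩ := Finset.mem_filter.1 hw
      obtain ⟨a, ha, haw⟩ := hdom w hwW (hnot w hwv hwA)
      refine ⟨a, (Finset.mem_insert.1 ha).resolve_left ?_, haw⟩
      rintro rfl
      exact hvw haw
    · obtain ⟨hwW, hwv, -⟩ := Finset.mem_filter.1 hw
      exact hW w hwW (hnot w hwv hwA)
    · rcases Finset.mem_union.1 ht with ht | ht
      · exact hT t ht
      · obtain ⟨htW, hvt⟩ := Finset.mem_filter.1 ht
        -- Independence keeps the neighbours of `v` out of `A`, so their variables kill `Y`.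
        exact hW t htW (hnot t hvt.ne' fun h => hvadj t h hvt)
    · have := card_filter_add_card_union_filter (G := G) hWT hv
      rw [Finset.card_insert_of_notMem hvA] at hn
      omega

theorem IsChordal.edgeIdealProjDim_le [Finite V] (hG : G.IsChordal) :
    G.edgeIdealProjDim k ≤ ((Nat.card V - G.indepDominationNumber : ℕ) : WithBot ℕ∞) := by
  have := Fintype.ofFinite V
  rw [edgeIdealProjDim, projectiveDimension_le_iff, ← edgeVarIdeal_univ_empty]
  refine hG.hasProjectiveDimensionLT_edgeVarIdeal _ _ (Finset.disjoint_empty_right _) _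
    fun A _ hind hdom => ?_
  have h : G.indepDominationNumber ≤ A.card :=
    Nat.sInf_le ⟨A, hind, fun w hw => hdom w (Finset.mem_univ w) hw, rfl⟩
  rw [Nat.card_eq_fintype_card, Finset.card_univ, Finset.card_empty]
  omega

theorem le_edgeIdealProjDim [Finite V] :
    ((Nat.card V - G.indepDominationNumber : ℕ) : WithBot ℕ∞) ≤ G.edgeIdealProjDim k := by
  classical
  have := Fintype.ofFinite V
  obtain ⟨A, hind, hdom, hcard⟩ := G.exists_card_eq_indepDominationNumber
  rw [edgeIdealProjDim, projectiveDimension_ge_iff, ← edgeVarIdeal_univ_empty]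
  intro hlt
  -- Evaluation at the indicator point of `A` makes `x_a` act as 1 for `a ∈ A` and the other
  -- variables as 0.
  let ε : MvPolynomial V k →+* k := MvPolynomial.eval fun w => if w ∈ A then 1 else 0
  let Y : ModuleCat.{max u v} (MvPolynomial V k) :=
    ModuleCat.of _ (MvPolynomial V k ⧸ RingHom.ker ε)
  have : Nontrivial Y := Ideal.Quotient.nontrivial_iff.2 (RingHom.ker_ne_top ε)
  have hone : ∀ a ∈ A, ∀ y : Y, (MvPolynomial.X a : MvPolynomial V k) • y = y := by
    intro a ha y
    obtain ⟨p, rfl⟩ := Submodule.Quotient.mk_surjective _ y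
    refine (Submodule.Quotient.eq _).2 ?_
    simp [RingHom.mem_ker, ε, ha]
  have hzero : ∀ w ∉ A, ∀ y : Y, (MvPolynomial.X w : MvPolynomial V k) • y = 0 := by
    intro a ha y
    obtain ⟨p, rfl⟩ := Submodule.Quotient.mk_surjective _ y
    refine (Submodule.Quotient.mk_eq_zero _).2 ?_
    simp [RingHom.mem_ker, ε, ha]
  have hnt := nontrivial_ext_edgeVarIdeal (G := G) (Y := Y) A Finset.univ ∅
    (Finset.disjoint_empty_right _) (Finset.subset_univ A) hind (fun w _ hw => hdom w hw) hone
    (fun w _ hw => hzero w hw) (fun t ht => absurd ht (Finset.notMem_empty t))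
    (Nat.card V - G.indepDominationNumber) (by
      have := G.indepDominationNumber_le_card
      rw [hcard, Finset.card_univ, Finset.card_empty, ← Nat.card_eq_fintype_card]
      omega)
  exact not_subsingleton_iff_nontrivial.2 hnt
    (HasProjectiveDimensionLT.subsingleton _ _ _ le_rfl Y)

end SimpleGraph

theorem corollary5p5 (k : Type v) [Field k] :
    SimpleGraph.IsHereditary.{u} SimpleGraph.IsChordal ∧
    SimpleGraph.HasNonDecreasingDeletion.{u} SimpleGraph.IsChordal
      SimpleGraph.dominationNumber ∧
    SimpleGraph.HasNonDecreasingDeletion.{u} SimpleGraph.IsChordal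
      SimpleGraph.indepDominationNumber ∧
    ∀ (V : Type u) [Finite V] (G : SimpleGraph V), G.IsChordal →
      G.edgeIdealProjDim k = ((Nat.card V - G.indepDominationNumber : ℕ) : WithBot ℕ∞) :=
  ⟨fun _ _ _ hG x => hG.deleteVertex x, SimpleGraph.hasNonDecreasingDeletion_dominationNumber,
    SimpleGraph.hasNonDecreasingDeletion_indepDominationNumber,
    fun _ _ _ hG => le_antisymm hG.edgeIdealProjDim_le SimpleGraph.le_edgeIdealProjDim⟩
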